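/- Let $\Phi$ denote the Galois conjugation of $\mathbb{Z}[\sqrt2]\subset\mathbb{R}$, $\Phi(m+n\sqrt2)=m-n\sqrt2$ for $m,n\in\mathbb{Z}$. Let $a,b,c$ be pairwise relatively prime positive integers, and let $u,v,w\in\mathbb{Z}[\sqrt2]$ be such that $u+\Phi(u)$, $v+\Phi(v)$ and $w+\Phi(w)$ are positive rational integers and $(u-\Phi(u))(v-\Phi(v))\neq 0$. Then the system of equations $$a x^{u}-b y^{v}=c z^{w},\qquad a x^{\Phi(u)}+b y^{\Phi(v)}=c z^{\Phi(w)}$$ has no solution in positive integers $x,y,z$ with $\gcd(x,y,z)=1$ and $xyz\neq 1$ (the powers are real powers of positive reals). -/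

import Mathlib

/-- The Galois conjugation `m + n√2 ↦ m - n√2` of the ring `ℤ[√2]`. -/
def conjSqrtTwo (u : ℤ√2) : ℤ√2 := star u

/-- The real number `m + n√2` given by an element of `ℤ[√2]`. -/
noncomputable def realSqrtTwo (u : ℤ√2) : ℝ :=
  Zsqrtd.toReal (d := 2) (by norm_num) u

theorem conjSqrtTwo_mk (m n : ℤ) : conjSqrtTwo ⟨m, n⟩ = ⟨m, -n⟩ := rfl

theorem realSqrtTwo_mk (m n : ℤ) :
    realSqrtTwo ⟨m, n⟩ = (m : ℝ) + (n : ℝ) * Real.sqrt 2 := by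
  simp [realSqrtTwo, Zsqrtd.toReal]

/-! Splitting each exponent as m + n√2 gives x^u = p·g^√2 with p, g positive rationals, and
conjugation replaces g^√2 by its inverse. With X, Y, Z the √2-th powers of g, h, j, the system reads
A X - B Y = C Z, A/X + B/Y = C/Z. Multiplying the equations eliminates Z and makes X/Y - Y/X
rational, so X/Y = (g/h)^√2 is algebraic and Gelfond–Schneider forces g = h. Then (A - B) X = C Z
makes X/Z rational, so g = j, and A - B = C = A + B contradicts B > 0.

Gelfond–Schneider for real powers (`NumberField.ne_rpow_of_irrational`) is proved with interpolation
determinants. If α, β, α^β lay in one number field, the functions t^i α^(jt) would take values in it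
at the points k + lβ. Their determinant is nonzero by a Rolle zero count
(`expPoly_eq_zero_of_zeros`), very small by power series (`abs_det_powerSeries_le`), and not that
small by a Liouville inequality (`NumberField.one_le_abs_det_mul_pow`). -/

/-! ### Zero estimate for real exponential polynomials. -/

open Polynomial in
/-- **Rolle's theorem** for finite sets of zeros. -/
theorem exists_finset_deriv_eq_zero {f : ℝ → ℝ} (hf : Differentiable ℝ f) (Z : Finset ℝ)
    (hZ : ∀ z ∈ Z, f z = 0) :
    ∃ Z' : Finset ℝ, Z.card ≤ Z'.card + 1 ∧ ∀ z ∈ Z', deriv f z = 0 := by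
  classical
  have key : ∀ x y : ℝ, ∃ c, x ∈ Z → y ∈ Z → x < y → c ∈ Set.Ioo x y ∧ deriv f c = 0 := by
    intro x y
    by_cases h : x ∈ Z ∧ y ∈ Z ∧ x < y
    · obtain ⟨c, hc, h0⟩ := exists_deriv_eq_zero h.2.2 hf.continuous.continuousOn
        ((hZ x h.1).trans (hZ y h.2.1).symm)
      exact ⟨c, fun _ _ _ => ⟨hc, h0⟩⟩
    · exact ⟨0, fun h1 h2 h3 => absurd ⟨h1, h2, h3⟩ h⟩
  choose c hc using key
  refine ⟨((Z ×ˢ Z).filter fun p => p.1 < p.2).image fun p => c p.1 p.2, ?_, ?_⟩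
  · refine Finset.card_le_of_interleaved fun x hx y hy hxy _ => ⟨c x y, ?_, (hc x y hx hy hxy).1⟩
    exact Finset.mem_image.2 ⟨(x, y), by simp [hx, hy, hxy], rfl⟩
  · intro z hz
    obtain ⟨p, hp, rfl⟩ := Finset.mem_image.1 hz
    simp only [Finset.mem_filter, Finset.mem_product] at hp
    exact (hc _ _ hp.1.1 hp.1.2 hp.2).2

open Polynomial in
/-- An exponential polynomial `∑ P ω (t) exp (ω t)` with `deg P ω < d ω` that vanishes at
`∑ d ω` distinct real points is trivial. -/
theorem expPoly_eq_zero_of_zeros (Ω : Finset ℝ) (d : ℝ → ℕ) (P : ℝ → ℝ[X])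
    (hP : ∀ ω ∈ Ω, (P ω).degree < d ω) (Z : Finset ℝ) (hcard : ∑ ω ∈ Ω, d ω ≤ Z.card)
    (hZ : ∀ t ∈ Z, ∑ ω ∈ Ω, (P ω).eval t * Real.exp (ω * t) = 0) :
    ∀ ω ∈ Ω, P ω = 0 := by
  classical
  induction hn : ∑ ω ∈ Ω, d ω generalizing d P Z with
  | zero =>
    intro ω hω
    have h := hP ω hω
    rw [Finset.sum_eq_zero_iff.1 hn ω hω] at h
    exact degree_eq_bot.1 (by simpa using h)
  | succ n ih =>
    obtain ⟨η, hη, hdη⟩ : ∃ η ∈ Ω, d η ≠ 0 := by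
      by_contra! h
      rw [Finset.sum_eq_zero h] at hn
      omega
    -- Shifting the frequency η to 0 makes differentiation lower the degree bound at η and keep the
    -- others: the budget `∑ d ω` drops by one, just as Rolle loses one zero.
    set G : ℝ → ℝ := fun t => ∑ ω ∈ Ω, (P ω).eval t * Real.exp ((ω - η) * t) with hG
    have hGF : ∀ t, G t = Real.exp (-η * t) * ∑ ω ∈ Ω, (P ω).eval t * Real.exp (ω * t) := by
      intro t
      simp only [hG, Finset.mul_sum]
      refine Finset.sum_congr rfl fun ω _ => ?_
      rw [mul_left_comm, ← Real.exp_add]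
      ring_nf
    set Q : ℝ → ℝ[X] := fun ω => derivative (P ω) + C (ω - η) * P ω with hQ
    have hG' : ∀ t, HasDerivAt G (∑ ω ∈ Ω, (Q ω).eval t * Real.exp ((ω - η) * t)) t := by
      intro t
      refine HasDerivAt.fun_sum fun ω _ => ?_
      have h1 := ((P ω).hasDerivAt t).mul (((hasDerivAt_id t).const_mul (ω - η)).exp)
      refine h1.congr_deriv ?_
      simp only [hQ, eval_add, eval_mul, eval_C, id]
      ring
    obtain ⟨Z', hZ'card, hZ'⟩ := exists_finset_deriv_eq_zero
      (fun t => (hG' t).differentiableAt) Z (fun z hz => by rw [hGF, hZ z hz, mul_zero])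
    have hd : ∑ ω ∈ Ω, Function.update d η (d η - 1) ω = n := by
      have h1 := Finset.sum_update_of_mem hη d (d η - 1)
      have h2 := Finset.sum_erase_add Ω d hη
      rw [Finset.sdiff_singleton_eq_erase] at h1
      omega
    have hQ0 : ∀ ω ∈ Ω, Q ω = 0 := by
      refine ih (Function.update d η (d η - 1)) Q ?_ Z' (by omega) ?_ hd
      · intro ω hω
        by_cases h : ω = η
        · subst h
          have hPω := hP ω hω
          simp only [hQ, sub_self, C_0, zero_mul, add_zero, Function.update_self]
          by_cases h0 : P ω = 0
          · simp [h0]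
          by_cases h1 : derivative (P ω) = 0
          · simp [h1]
          have h2 := degree_derivative_lt h0
          rw [degree_eq_natDegree h0] at hPω h2
          rw [degree_eq_natDegree h1] at h2 ⊢
          norm_cast at *
          omega
        · rw [Function.update_of_ne h]
          refine (degree_add_le _ _).trans_lt (max_lt ?_ ?_)
          · exact (degree_derivative_le).trans_lt (hP ω hω)
          · rw [degree_C_mul (sub_ne_zero.2 h)]
            exact hP ω hω
      · intro t ht
        have h := hZ' t ht
        rw [(hG' t).deriv] at h
        have h2 : ∑ ω ∈ Ω, (Q ω).eval t * Real.exp (ω * t)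
            = Real.exp (η * t) * ∑ ω ∈ Ω, (Q ω).eval t * Real.exp ((ω - η) * t) := by
          rw [Finset.mul_sum]
          refine Finset.sum_congr rfl fun ω _ => ?_
          rw [mul_left_comm, ← Real.exp_add]
          ring_nf
        rw [h2, h, mul_zero]
    -- Off η, P' = -(ω - η) P is impossible by degree unless P = 0; at η only a constant survives,
    -- and a single zero kills it.
    have hne : ∀ ω ∈ Ω, ω ≠ η → P ω = 0 := by
      intro ω hω h
      by_contra h0
      have h1 : derivative (P ω) = - (C (ω - η) * P ω) := eq_neg_of_add_eq_zero_left (hQ0 ω hω)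
      have h2 := degree_derivative_lt h0
      rw [h1, degree_neg, degree_C_mul (sub_ne_zero.2 h)] at h2
      exact lt_irrefl _ h2
    have hη' : P η = C ((P η).coeff 0) := by
      have h1 := hQ0 η hη
      simp only [hQ, sub_self, C_0, zero_mul, add_zero] at h1
      exact eq_C_of_derivative_eq_zero h1
    intro ω hω
    by_cases h : ω = η
    · subst h
      obtain ⟨z, hz⟩ : Z.Nonempty := Finset.card_pos.1 (by omega)
      have h1 := hZ z hz
      rw [Finset.sum_eq_single_of_mem ω hω (fun b hb hbne => by simp [hne b hb hbne]),
        hη', eval_C] at h1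
      rw [hη', (mul_eq_zero.1 h1).resolve_right (Real.exp_ne_zero _), C_0]
    · exact hne ω hω h

/-! ### Analytic upper bound for interpolation determinants. -/

theorem Finset.sum_range_card_le_sum (s : Finset ℕ) : ∑ i ∈ Finset.range s.card, i ≤ ∑ x ∈ s, x := by
  induction s using Finset.induction_on_max with
  | empty => simp
  | insert a t ha ih =>
    have hat : a ∉ t := fun h => lt_irrefl _ (ha a h)
    have hcard : t.card ≤ a := by
      simpa using Finset.card_le_card fun x hx => Finset.mem_range.2 (ha x hx)
    rw [Finset.card_insert_of_notMem hat, Finset.sum_range_succ, Finset.sum_insert hat]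
    omega

theorem sum_range_card_le_sum_of_injective {ι : Type*} [Fintype ι] {g : ι → ℕ}
    (hg : Function.Injective g) : ∑ i ∈ Finset.range (Fintype.card ι), i ≤ ∑ i, g i := by
  simpa using Finset.sum_range_card_le_sum (Finset.univ.map ⟨g, hg⟩)

theorem Matrix.norm_det_le_factorial_mul_prod {ι R : Type*} [Fintype ι] [DecidableEq ι]
    [NormedField R] (A : Matrix ι ι R) (B : ι → ℝ) (hA : ∀ i j, ‖A i j‖ ≤ B i) :
    ‖A.det‖ ≤ (Fintype.card ι).factorial * ∏ i, B i := by
  rw [← Matrix.det_transpose, Matrix.det_apply]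
  refine (norm_sum_le _ _).trans ?_
  have h : ∀ σ ∈ (Finset.univ : Finset (Equiv.Perm ι)),
      ‖Equiv.Perm.sign σ • ∏ i, A.transpose (σ i) i‖ ≤ ∏ i, B i := by
    intro σ _
    have h1 : ‖Equiv.Perm.sign σ • ∏ i, A.transpose (σ i) i‖ = ∏ i, ‖A i (σ i)‖ := by
      rcases Int.units_eq_one_or (Equiv.Perm.sign σ) with h | h <;> simp [h, norm_prod]
    rw [h1]
    exact Finset.prod_le_prod (fun i _ => norm_nonneg _) fun i _ => hA i (σ i)
  refine (Finset.sum_le_card_nsmul _ _ _ h).trans ?_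
  simp [Fintype.card_perm]

/-- Interpolation determinants of polynomials are small. -/
theorem abs_det_polynomial_le {ι : Type*} [Fintype ι] [DecidableEq ι] (M : ℕ) (c : ι → ℕ → ℝ)
    (t : ι → ℝ) (r E : ℝ) (hr : 0 ≤ r) (hE : 1 ≤ E) (ht : ∀ j, |t j| ≤ r) :
    |(Matrix.of fun i j => ∑ n ∈ Finset.range M, c i n * t j ^ n).det| ≤
      (Fintype.card ι).factorial * (∏ i, ∑ n ∈ Finset.range M, |c i n| * (E * r) ^ n) /
        E ^ (∑ i ∈ Finset.range (Fintype.card ι), i) := by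
  have hE0 : 0 < E := by linarith
  -- Multilinear expansion in the rows. Repeated exponents give equal rows; distinct ones sum to at
  -- least 0 + 1 + ... + (N - 1), N the size of the matrix, which is the source of the power of E
  -- saved.
  have h1 : (Matrix.of fun i j => ∑ n ∈ Finset.range M, c i n * t j ^ n).det =
      ∑ g ∈ Fintype.piFinset fun _ : ι => Finset.range M,
        (∏ i, c i (g i)) * (Matrix.of fun i j => t j ^ g i).det := by
    have h2 := (Matrix.detRowAlternating (n := ι) (R := ℝ)).toMultilinearMap.map_sum_finset
      (fun i n => c i n • fun j => t j ^ n) (fun _ => Finset.range M)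
    have h3 : (Matrix.of fun i j => ∑ n ∈ Finset.range M, c i n * t j ^ n) =
        fun i => ∑ n ∈ Finset.range M, c i n • fun j => t j ^ n := by
      ext i j
      simp [Finset.sum_apply]
    rw [h3]
    refine Eq.trans h2 (Finset.sum_congr rfl fun g _ => ?_)
    exact (Matrix.detRowAlternating (n := ι) (R := ℝ)).toMultilinearMap.map_smul_univ
      (fun i => c i (g i)) (fun i j => t j ^ g i)
  rw [h1, Finset.prod_univ_sum, Finset.mul_sum, Finset.sum_div]
  refine (Finset.abs_sum_le_sum_abs _ _).trans (Finset.sum_le_sum fun g _ => ?_)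
  rw [abs_mul, Finset.abs_prod, Finset.prod_mul_distrib]
  by_cases hg : Function.Injective g
  · have h2 : |(Matrix.of fun i j => t j ^ g i).det| ≤
        (Fintype.card ι).factorial * ∏ i, r ^ g i :=
      Matrix.norm_det_le_factorial_mul_prod (Matrix.of fun i j => t j ^ g i) _ fun i j => by
        simpa using pow_le_pow_left₀ (abs_nonneg _) (ht j) (g i)
    have h3 : ∏ i, r ^ g i ≤
        (∏ i, (E * r) ^ g i) / E ^ (∑ i ∈ Finset.range (Fintype.card ι), i) := by
      rw [le_div_iff₀ (by positivity)]
      simp only [mul_pow, Finset.prod_mul_distrib, Finset.prod_pow_eq_pow_sum]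
      rw [mul_comm]
      refine mul_le_mul_of_nonneg_right (pow_le_pow_right₀ hE ?_) (by positivity)
      · exact sum_range_card_le_sum_of_injective hg
    calc _ ≤ (∏ i, |c i (g i)|) * ((Fintype.card ι).factorial *
          ((∏ i, (E * r) ^ g i) / E ^ (∑ i ∈ Finset.range (Fintype.card ι), i))) := by
          gcongr
          exact h2.trans (by gcongr)
      _ = _ := by ring
  · have h2 : (Matrix.of fun i j => t j ^ g i).det = 0 := by
      simp only [Function.Injective, not_forall] at hg
      obtain ⟨i, k, hik, hne⟩ := hg
      exact Matrix.det_zero_of_row_eq hne (by ext j; simp [hik])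
    rw [h2, abs_zero, mul_zero]
    positivity

open Filter Topology in
/-- Interpolation determinants of functions given by power series are small. -/
theorem abs_det_powerSeries_le {ι : Type*} [Fintype ι] [DecidableEq ι] (c : ι → ℕ → ℝ)
    (f : ι → ℝ → ℝ) (t : ι → ℝ) (B : ι → ℝ) (r E : ℝ) (hr : 0 ≤ r) (hE : 1 ≤ E)
    (ht : ∀ j, |t j| ≤ r) (hf : ∀ i j, HasSum (fun n => c i n * t j ^ n) (f i (t j)))
    (hB : ∀ i, HasSum (fun n => |c i n| * (E * r) ^ n) (B i)) :
    |(Matrix.of fun i j => f i (t j)).det| ≤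
      (Fintype.card ι).factorial * (∏ i, B i) /
        E ^ (∑ i ∈ Finset.range (Fintype.card ι), i) := by
  have hE0 : 0 < E := by linarith
  have h1 : Tendsto (fun M => Matrix.of fun i j => ∑ n ∈ Finset.range M, c i n * t j ^ n) atTop
      (𝓝 (Matrix.of fun i j => f i (t j))) :=
    tendsto_pi_nhds.2 fun i => tendsto_pi_nhds.2 fun j => (hf i j).tendsto_sum_nat
  have h2 := ((continuous_id.matrix_det.tendsto
    (Matrix.of fun i j => f i (t j))).comp h1).abs
  refine le_of_tendsto h2 (Eventually.of_forall fun M => ?_)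
  refine (abs_det_polynomial_le M c t r E hr hE ht).trans ?_
  gcongr with i
  exact sum_le_hasSum _ (fun n _ => by positivity) (hB i)

-- A left kernel vector is the coefficient list of an exponential polynomial with K frequencies and
-- degrees below D, vanishing at D·K distinct points.
open Polynomial in
theorem det_pow_mul_exp_ne_zero {D K : ℕ} {lam : ℝ} (hlam : lam ≠ 0) (t : Fin D × Fin K → ℝ)
    (ht : Function.Injective t) :
    (Matrix.of fun p q : Fin D × Fin K =>
      t q ^ (p.1 : ℕ) * Real.exp (p.2 * lam * t q)).det ≠ 0 := by
  classical
  intro h0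
  obtain ⟨v, hv, hv0⟩ := Matrix.exists_vecMul_eq_zero_iff.2 h0
  have hinj : Function.Injective fun j : Fin K => (j : ℝ) * lam := fun i j hij =>
    Fin.ext (by exact_mod_cast mul_right_cancel₀ hlam hij)
  set F : Fin K → ℝ[X] := fun j => ∑ i : Fin D, C (v (i, j)) * X ^ (i : ℕ) with hF
  set P : ℝ → ℝ[X] := Function.extend (fun j : Fin K => (j : ℝ) * lam) F 0 with hP
  have hPF : ∀ j : Fin K, P ((j : ℝ) * lam) = F j := fun j => hinj.extend_apply F 0 j
  set e : Fin K ↪ ℝ := ⟨fun j => (j : ℝ) * lam, hinj⟩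
  have hz := expPoly_eq_zero_of_zeros (Finset.univ.map e) (fun _ => D) P ?_ (Finset.univ.map ⟨t, ht⟩)
    ?_ ?_
  · apply hv
    ext ⟨i, j⟩
    have h1 : F j = 0 := by
      rw [← hPF j]
      exact hz _ (Finset.mem_map_of_mem e (Finset.mem_univ j))
    have h2 : (F j).coeff (i : ℕ) = v (i, j) := by
      simp only [hF, finsetSum_coeff, coeff_C_mul, coeff_X_pow, Fin.val_inj]
      simp
    rw [← h2, h1]
    simp
  · intro ω hω
    obtain ⟨j, -, rfl⟩ := Finset.mem_map.1 hω
    change (P ((j : ℝ) * lam)).degree < _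
    rw [hPF]
    refine (degree_sum_le _ _).trans_lt ((Finset.sup_lt_iff (WithBot.bot_lt_coe D)).2 fun i _ => ?_)
    exact (degree_C_mul_X_pow_le _ _).trans_lt (WithBot.coe_lt_coe.2 i.2)
  · simp [mul_comm]
  · intro s hs
    obtain ⟨q, -, rfl⟩ := Finset.mem_map.1 hs
    rw [Finset.sum_map]
    have h1 := congrFun hv0 q
    simp only [Matrix.vecMul, dotProduct, Matrix.of_apply, Pi.zero_apply, Fintype.sum_prod_type_right] at h1
    rw [← h1]
    refine Finset.sum_congr rfl fun j _ => ?_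
    change (P ((j : ℝ) * lam)).eval (t q) * Real.exp ((j : ℝ) * lam * t q) = _
    rw [hPF, hF, eval_finsetSum, Finset.sum_mul]
    refine Finset.sum_congr rfl fun i _ => ?_
    simp [mul_assoc]

theorem hasSum_pow_mul_exp (i : ℕ) (a t : ℝ) :
    HasSum (fun n => (if i ≤ n then a ^ (n - i) / (n - i).factorial else 0) * t ^ n)
      (t ^ i * Real.exp (a * t)) := by
  rw [← hasSum_nat_add_iff' i]
  have h0 : ∑ n ∈ Finset.range i,
      (if i ≤ n then a ^ (n - i) / (n - i).factorial else 0) * t ^ n = 0 :=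
    Finset.sum_eq_zero fun n hn => by simp [Finset.mem_range.1 hn]
  rw [h0, sub_zero]
  have h1 := (NormedSpace.expSeries_div_hasSum_exp (a * t)).mul_left (t ^ i)
  rw [← Real.exp_eq_exp_ℝ] at h1
  refine h1.congr_fun fun n => ?_
  simp only [le_add_iff_nonneg_left, zero_le, if_true, Nat.add_sub_cancel]
  rw [mul_pow, pow_add]
  ring

/-- The series of absolute values is the same function with |lam| in place of lam, evaluated at E r.
-/
theorem abs_det_pow_mul_exp_le {D K : ℕ} (lam : ℝ) (t : Fin D × Fin K → ℝ) (r E : ℝ)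
    (hr : 1 ≤ r) (hE : 1 ≤ E) (ht : ∀ j, |t j| ≤ r) :
    |(Matrix.of fun p q : Fin D × Fin K =>
      t q ^ (p.1 : ℕ) * Real.exp (p.2 * lam * t q)).det| ≤
      (D * K).factorial * ((E * r) ^ D * Real.exp (K * |lam| * (E * r))) ^ (D * K) /
        E ^ (∑ i ∈ Finset.range (D * K), i) := by
  have hEr : 1 ≤ E * r := by nlinarith
  have h := abs_det_powerSeries_le
    (fun (p : Fin D × Fin K) n =>
      if (p.1 : ℕ) ≤ n then (p.2 * lam) ^ (n - p.1) / (n - p.1).factorial else 0)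
    (fun p s => s ^ (p.1 : ℕ) * Real.exp (p.2 * lam * s)) t
    (fun p => (E * r) ^ (p.1 : ℕ) * Real.exp (p.2 * |lam| * (E * r))) r E (by linarith) hE ht
    (fun p q => hasSum_pow_mul_exp p.1 (p.2 * lam) (t q))
    (fun p => by
      refine (hasSum_pow_mul_exp p.1 (p.2 * |lam|) (E * r)).congr_fun fun n => ?_
      split_ifs <;> simp [abs_div, abs_mul, abs_pow])
  simp only [Fintype.card_prod, Fintype.card_fin] at h
  refine h.trans ?_
  gcongr
  refine (Finset.prod_le_prod (g := fun _ => (E * r) ^ D * Real.exp (K * |lam| * (E * r)))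
    (fun p _ => by positivity) ?_).trans (le_of_eq (by simp))
  rintro ⟨i, j⟩ -
  have hj : (j : ℝ) ≤ K := by exact_mod_cast j.2.le
  dsimp only
  gcongr
  exact i.2.le

/-! ### Arithmetic lower bound. -/

open NumberField in
/-- A Liouville type inequality in a number field. -/
theorem NumberField.one_le_norm_mul_pow_of_isIntegral {F : Type*} [Field F] [NumberField F]
    (φ : F →+* ℂ) {x : F} (hx : IsIntegral ℤ x) (hx0 : x ≠ 0) {H : ℝ}
    (hH : ∀ σ : F →+* ℂ, ‖σ x‖ ≤ H) :
    1 ≤ ‖φ x‖ * H ^ (Module.finrank ℚ F - 1) := by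
  -- The norm is a nonzero rational integer; as a product over embeddings, it is bounded by keeping
  -- φ and estimating the other factors by H.
  have h1 : (1 : ℝ) ≤ ‖Algebra.norm ℚ x‖ := by
    obtain ⟨n, hn⟩ := IsIntegrallyClosed.isIntegral_iff.1 (Algebra.isIntegral_norm ℚ hx)
    have hn0 : n ≠ 0 := by
      rintro rfl
      exact hx0 (Algebra.norm_eq_zero_iff.1 (hn.symm.trans (map_zero _)))
    rw [← hn]
    rw [eq_intCast, Int.norm_cast_rat, Int.norm_eq_abs]
    exact_mod_cast Int.one_le_abs hn0
  have hH0 : 0 ≤ H := (norm_nonneg _).trans (hH φ)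
  have h2 : house x ≤ H := (pi_norm_le_iff_of_nonneg hH0).2 hH
  refine (h1.trans (norm_norm_le_norm_mul_house_pow x φ)).trans ?_
  gcongr
  exact house_nonneg x

theorem NumberField.one_le_abs_det_mul_pow {F ι : Type*} [Field F] [NumberField F] [Fintype ι]
    [DecidableEq ι] (φ : F →+* ℝ) (A : Matrix ι ι F) (hA : A.det ≠ 0) {y : ℤ} (hy : y ≠ 0) (w : ℕ)
    (hint : ∀ i j, IsIntegral ℤ ((y : F) ^ w * A i j)) {H : ℝ}
    (hH : ∀ (σ : F →+* ℂ) i j, ‖σ (A i j)‖ ≤ H) :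
    1 ≤ ((|y| : ℝ) ^ w) ^ Fintype.card ι * |φ A.det| *
      ((Fintype.card ι).factorial * ((|y| : ℝ) ^ w * H) ^ Fintype.card ι) ^
        (Module.finrank ℚ F - 1) := by
  have hdet : (((y : F) ^ w) • A).det = ((y : F) ^ w) ^ Fintype.card ι * A.det :=
    Matrix.det_smul _ _
  have hint' : IsIntegral ℤ (((y : F) ^ w) • A).det :=
    IsIntegral.det fun i j => hint i j
  have hy' : (y : F) ≠ 0 := by exact_mod_cast hy
  have h := NumberField.one_le_norm_mul_pow_of_isIntegral (Complex.ofRealHom.comp φ) hint'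
    (by rw [hdet]; exact mul_ne_zero (by positivity) hA)
    (H := (Fintype.card ι).factorial * ((|y| : ℝ) ^ w * H) ^ Fintype.card ι) (by
      intro σ
      rw [RingHom.map_det]
      refine (Matrix.norm_det_le_factorial_mul_prod _ (fun _ => (|y| : ℝ) ^ w * H) ?_).trans
        (le_of_eq (by simp))
      intro i j
      simp only [RingHom.mapMatrix_apply, Matrix.map_apply, Matrix.smul_apply, smul_eq_mul,
        map_mul, map_pow, map_intCast, norm_mul, norm_pow, Complex.norm_intCast]
      gcongr
      exact hH σ i j)
  rw [hdet] at h
  simpa [abs_mul, abs_pow] using h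

/-- Each factor of the entry absorbs one y as denominator, and there are i + jk + jl factors. -/
theorem isIntegral_interpolation_entry {F : Type*} [Field F] {y α β τ : F} (hy : IsIntegral ℤ y)
    (hα : IsIntegral ℤ (y * α)) (hβ : IsIntegral ℤ (y * β)) (hτ : IsIntegral ℤ (y * τ))
    (w i j k l : ℕ) (hw : i + j * k + j * l ≤ w) :
    IsIntegral ℤ (y ^ w * (((k : F) + l * β) ^ i * (α ^ (j * k) * τ ^ (j * l)))) := by
  obtain ⟨v, rfl⟩ := Nat.exists_eq_add_of_le hw
  have h : y ^ (i + j * k + j * l + v) * (((k : F) + l * β) ^ i * (α ^ (j * k) * τ ^ (j * l))) =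
      y ^ v * ((k * y + l * (y * β)) ^ i * ((y * α) ^ (j * k) * (y * τ) ^ (j * l))) := by
    have h1 : (k * y + l * (y * β)) = y * ((k : F) + l * β) := by ring
    rw [h1, mul_pow, mul_pow, mul_pow]
    ring
  have hk : ∀ n : ℕ, IsIntegral ℤ (n : F) := fun n => by
    simpa using isIntegral_algebraMap (R := ℤ) (A := F) (x := (n : ℤ))
  rw [h]
  exact (hy.pow _).mul (((((hk k).mul hy).add ((hk l).mul hβ)).pow _).mul
    ((hα.pow _).mul (hτ.pow _)))

theorem norm_natCast_add_mul_le {β : ℂ} {m : ℝ} (hβ : 1 + ‖β‖ ≤ m) {k l : ℕ}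
    (hk : (k : ℝ) ≤ m ^ 2) (hl : (l : ℝ) ≤ m ^ 2) : ‖(k : ℂ) + l * β‖ ≤ m ^ 3 := by
  calc ‖(k : ℂ) + l * β‖ ≤ ‖(k : ℂ)‖ + ‖(l : ℂ) * β‖ := norm_add_le _ _
    _ = k + l * ‖β‖ := by simp
    _ ≤ m ^ 2 + m ^ 2 * ‖β‖ := by gcongr
    _ = m ^ 2 * (1 + ‖β‖) := by ring
    _ ≤ m ^ 2 * m := by gcongr
    _ = m ^ 3 := by ring

theorem norm_interpolation_entry_le {α β τ : ℂ} {C m : ℝ} (hC : 1 ≤ C) (hm : C ≤ m)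
    (hα : ‖α‖ ≤ C) (hβ : 1 + ‖β‖ ≤ C) (hτ : ‖τ‖ ≤ C) {S D i j k l : ℕ} (hS : (S : ℝ) = m ^ 2)
    (hi : i ≤ D) (hk : k ≤ S) (hl : l ≤ S) (hw : j * k + j * l ≤ D) :
    ‖((k : ℂ) + l * β) ^ i * (α ^ (j * k) * τ ^ (j * l))‖ ≤ m ^ (4 * D) := by
  have hm1 : 1 ≤ m := hC.trans hm
  have hk' : (k : ℝ) ≤ m ^ 2 := hS ▸ (by exact_mod_cast hk)
  have hl' : (l : ℝ) ≤ m ^ 2 := hS ▸ (by exact_mod_cast hl)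
  have h1 := norm_natCast_add_mul_le (hβ.trans hm) hk' hl'
  rw [norm_mul, norm_mul, norm_pow, norm_pow, norm_pow]
  calc _ ≤ (m ^ 3) ^ i * (m ^ (j * k) * m ^ (j * l)) := by
        gcongr
        · exact hα.trans hm
        · exact hτ.trans hm
    _ = m ^ (3 * i + (j * k + j * l)) := by rw [← pow_mul, ← pow_add, ← pow_add]
    _ ≤ m ^ (4 * D) := pow_le_pow_right₀ hm1 (by omega)

/-! ### Choice of parameters and the Gelfond–Schneider theorem. -/

/-- The final numerical contradiction between the arithmetic and the analytic bounds. -/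
theorem interpolation_bounds_absurd {d D K N : ℕ} {m C lam Y δ : ℝ} (hd : 0 < d)
    (hK : K = 14 * d + 4) (hN : N = D * K) (hNm : (N : ℝ) = m ^ 4) (hD : 4 ≤ D) (hm : 2 ≤ m)
    (hlam : |lam| ≤ C) (hmC : Real.exp (K ^ 2 * C) ≤ m) (hY0 : 0 ≤ Y) (hY : Y ≤ m)
    (hδ0 : 0 ≤ δ)
    (hδ : δ ≤ N.factorial * ((m * m ^ 3) ^ D * Real.exp (K * |lam| * (m * m ^ 3))) ^ N /
      m ^ (∑ i ∈ Finset.range N, i))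
    (h1 : 1 ≤ (Y ^ (2 * D)) ^ N * δ *
      (N.factorial * (Y ^ (2 * D) * m ^ (4 * D)) ^ N) ^ (d - 1)) : False := by
  have hm0 : 0 < m := by linarith
  have hm1 : 1 ≤ m := by linarith
  have hfac : (N.factorial : ℝ) ≤ m ^ (D * N) := by
    calc (N.factorial : ℝ) ≤ (N : ℝ) ^ N := by exact_mod_cast Nat.factorial_le_pow N
      _ = m ^ (4 * N) := by rw [hNm, ← pow_mul]
      _ ≤ m ^ (D * N) := pow_le_pow_right₀ hm1 (Nat.mul_le_mul_right _ hD)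
  have hexp : Real.exp (K * |lam| * (m * m ^ 3)) ≤ m ^ D := by
    have h2 : m * m ^ 3 = D * K := by
      have : (N : ℝ) = D * K := by rw [hN]; push_cast; ring
      rw [← this, hNm]; ring
    calc _ ≤ Real.exp (D * (K ^ 2 * C)) := by
          rw [h2]
          refine Real.exp_le_exp.2 ?_
          calc (K : ℝ) * |lam| * (D * K) = D * (K ^ 2 * |lam|) := by ring
            _ ≤ _ := by gcongr
      _ = Real.exp (K ^ 2 * C) ^ D := Real.exp_nat_mul _ _
      _ ≤ m ^ D := by gcongr
  have hδ' : δ * m ^ (∑ i ∈ Finset.range N, i) ≤ m ^ (6 * (D * N)) := by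
    rw [le_div_iff₀ (by positivity)] at hδ
    refine hδ.trans ?_
    calc _ ≤ m ^ (D * N) * ((m * m ^ 3) ^ D * m ^ D) ^ N := by gcongr
      _ = m ^ (6 * (D * N)) := by ring
  have hYD : Y ^ (2 * D) ≤ m ^ (2 * D) := by gcongr
  -- Exponents in units of D N: 2 (denominators) + 6 (analytic bound) at the real place, and 1 + 2 +
  -- 4 = 7 for each of the d - 1 other embeddings, in total 7d + 1. The choice K = 14d + 4 makes (N
  -- - 1)/2 exceed (7d + 1) D.
  have h3 : m ^ (∑ i ∈ Finset.range N, i) ≤ m ^ ((7 * d + 1) * (D * N)) := by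
    calc m ^ (∑ i ∈ Finset.range N, i) ≤ m ^ (∑ i ∈ Finset.range N, i) * _ :=
          le_mul_of_one_le_right (by positivity) h1
      _ = (Y ^ (2 * D)) ^ N * (δ * m ^ (∑ i ∈ Finset.range N, i)) *
          (N.factorial * (Y ^ (2 * D) * m ^ (4 * D)) ^ N) ^ (d - 1) := by ring
      _ ≤ (m ^ (2 * D)) ^ N * m ^ (6 * (D * N)) *
          (m ^ (D * N) * (m ^ (2 * D) * m ^ (4 * D)) ^ N) ^ (d - 1) := by gcongr
      _ = m ^ (8 * (D * N) + 7 * (D * N) * (d - 1)) := by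
          rw [← pow_add, ← pow_mul, ← pow_mul, ← pow_add, ← pow_add, ← pow_mul, ← pow_add]
          congr 1
          ring
      _ = m ^ ((7 * d + 1) * (D * N)) := by
          obtain ⟨e, rfl⟩ := Nat.exists_eq_add_of_lt hd
          congr 1
          simp only [zero_add, Nat.add_sub_cancel]
          ring
  have h4 := (pow_le_pow_iff_right₀ (by linarith : 1 < m)).1 h3
  have h5 := Finset.sum_range_id_mul_two N
  have hNpos : 0 < N := by rw [hN, hK]; positivity
  have h6 : N * (N - 1) ≤ N * (2 * ((7 * d + 1) * D)) := by
    rw [← h5]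
    calc _ ≤ (7 * d + 1) * (D * N) * 2 := Nat.mul_le_mul_right _ h4
      _ = _ := by ring
  have h7 := Nat.le_of_mul_le_mul_left h6 hNpos
  have h8 : N = 2 * ((7 * d + 1) * D) + 2 * D := by rw [hN, hK]; ring
  omega

theorem Irrational.natCast_add_mul_injective {β : ℝ} (hβ : Irrational β) :
    Function.Injective fun p : ℕ × ℕ => (p.1 : ℝ) + p.2 * β := by
  rintro ⟨k, l⟩ ⟨k', l'⟩ h
  dsimp only at h
  have hl : l = l' := by
    by_contra hne
    have h0 : (l : ℝ) - l' ≠ 0 := sub_ne_zero.2 (by exact_mod_cast hne)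
    refine hβ ⟨((k' : ℚ) - k) / ((l : ℚ) - l'), ?_⟩
    push_cast
    rw [div_eq_iff h0]
    linarith
  subst hl
  simpa using h

open Module in
/-- The **Gelfond–Schneider theorem** for real powers, inside a number field with a real place. -/
theorem NumberField.ne_rpow_of_irrational {F : Type*} [Field F] [NumberField F] (φ : F →+* ℝ)
    (α β τ : F) (hα0 : 0 < φ α) (hα1 : φ α ≠ 1) (hβ : Irrational (φ β)) :
    φ τ ≠ φ α ^ φ β := by
  classical
  intro hτ
  set lam := Real.log (φ α) with hlam
  have hlam0 : lam ≠ 0 := Real.log_ne_zero_of_pos_of_ne_one hα0 hα1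
  have hαe : φ α = Real.exp lam := (Real.exp_log hα0).symm
  have hτe : φ τ = Real.exp (lam * φ β) := by rw [hτ, Real.rpow_def_of_pos hα0]
  have : Algebra.IsAlgebraic ℤ F := (IsFractionRing.comap_isAlgebraic_iff (K := ℚ)).2 inferInstance
  obtain ⟨y, hy0, hy⟩ : ∃ y : ℤ, y ≠ 0 ∧ ∀ z ∈ ({α, β, τ} : Finset F), IsIntegral ℤ (y • z) :=
    Algebra.IsAlgebraic.exists_integral_multiples ℤ _
  simp only [zsmul_eq_mul, Finset.mem_insert, Finset.mem_singleton, forall_eq_or_imp,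
    forall_eq] at hy
  obtain ⟨C, hC1, hyC, hlamC, hσC⟩ : ∃ C : ℝ, 1 ≤ C ∧ |(y : ℝ)| ≤ C ∧ |lam| ≤ C ∧
      ∀ σ : F →+* ℂ, ‖σ α‖ ≤ C ∧ 1 + ‖σ β‖ ≤ C ∧ ‖σ τ‖ ≤ C := by
    have h0 : 0 ≤ ∑ σ : F →+* ℂ, (‖σ α‖ + ‖σ β‖ + ‖σ τ‖) := by positivity
    refine ⟨1 + |(y : ℝ)| + |lam| + ∑ σ : F →+* ℂ, (‖σ α‖ + ‖σ β‖ + ‖σ τ‖), ?_, ?_, ?_, ?_⟩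
    · linarith [abs_nonneg (y : ℝ), abs_nonneg lam]
    · linarith [abs_nonneg lam]
    · linarith [abs_nonneg (y : ℝ)]
    · intro σ
      have h := Finset.single_le_sum (f := fun σ : F →+* ℂ => ‖σ α‖ + ‖σ β‖ + ‖σ τ‖)
        (fun σ _ => by positivity) (Finset.mem_univ σ)
      have h1 := norm_nonneg (σ α)
      have h2 := norm_nonneg (σ β)
      have h3 := norm_nonneg (σ τ)
      have h4 := abs_nonneg (y : ℝ)
      have h5 := abs_nonneg lam
      refine ⟨?_, ?_, ?_⟩ <;> linarith
  set d := finrank ℚ F with hd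
  have hd0 : 0 < d := finrank_pos
  obtain ⟨K, hK⟩ : ∃ K, K = 14 * d + 4 := ⟨_, rfl⟩
  obtain ⟨n, hn2, hnC, hne⟩ : ∃ n : ℕ, 2 ≤ n ∧ C ≤ n ∧ Real.exp (K ^ 2 * C) ≤ n := by
    refine ⟨2 + ⌈C⌉₊ + ⌈Real.exp (K ^ 2 * C)⌉₊, by omega, ?_, ?_⟩
    · refine (Nat.le_ceil C).trans ?_
      exact_mod_cast (by omega)
    · refine (Nat.le_ceil _).trans ?_
      exact_mod_cast (by omega)
  set m : ℕ := K * n with hm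
  have hnm : n ≤ m := Nat.le_mul_of_pos_left n (by omega)
  have hnm' : (n : ℝ) ≤ m := by exact_mod_cast hnm
  have hCm : C ≤ m := hnC.trans hnm'
  -- With m = K n this gives D K = m^4, as many functions as points k + lβ with k, l < m^2; n ≥ 2
  -- leaves room for jk + jl ≤ D.
  set D := K ^ 3 * n ^ 4 with hD
  have hDpos : 4 ≤ D := by
    calc 4 ≤ 1 * 2 ^ 4 := by norm_num
      _ ≤ K ^ 3 * n ^ 4 := Nat.mul_le_mul (Nat.one_le_pow _ _ (by omega))
        (Nat.pow_le_pow_left hn2 4)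
  have hKSD : K * m ^ 2 + K * m ^ 2 ≤ D := by
    calc K * m ^ 2 + K * m ^ 2 = K ^ 3 * (n ^ 2 * 2) := by rw [hm]; ring
      _ ≤ K ^ 3 * (n ^ 2 * n ^ 2) := by gcongr; nlinarith
      _ = D := by rw [hD]; ring
  have hcard : D * K = m ^ 4 := by rw [hD, hm]; ring
  -- Any bijection will do: it only labels the points by the column index.
  let e : Fin D × Fin K ≃ Fin (m ^ 2) × Fin (m ^ 2) := Fintype.equivOfCardEq (by
    simp only [Fintype.card_prod, Fintype.card_fin, hcard]; ring)
  set A : Matrix (Fin D × Fin K) (Fin D × Fin K) F := Matrix.of fun p q =>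
    (((e q).1 : ℕ) + ((e q).2 : ℕ) * β : F) ^ (p.1 : ℕ) *
      (α ^ ((p.2 : ℕ) * (e q).1) * τ ^ ((p.2 : ℕ) * (e q).2)) with hA
  set t : Fin D × Fin K → ℝ := fun q => ((e q).1 : ℕ) + ((e q).2 : ℕ) * φ β with ht
  have htinj : Function.Injective t := by
    intro q q' hq
    have h := hβ.natCast_add_mul_injective (a₁ := ((e q).1, (e q).2))
      (a₂ := ((e q').1, (e q').2)) hq
    simp only [Prod.mk.injEq, Fin.val_inj] at h
    exact e.injective (Prod.ext h.1 h.2)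
  have hdet : φ A.det = (Matrix.of fun p q : Fin D × Fin K =>
      t q ^ (p.1 : ℕ) * Real.exp (p.2 * lam * t q)).det := by
    rw [RingHom.map_det]
    congr 1
    ext p q
    simp only [hA, ht, RingHom.mapMatrix_apply, Matrix.map_apply, Matrix.of_apply, map_mul,
      map_pow, map_add, map_natCast, hαe, hτe, ← Real.exp_nat_mul, ← Real.exp_add]
    congr 2
    push_cast
    ring
  have hdet0 : φ A.det ≠ 0 := hdet ▸ det_pow_mul_exp_ne_zero hlam0 t htinj
  have hfin : ∀ i : Fin (m ^ 2), ((i : ℕ) : ℝ) ≤ (m : ℝ) ^ 2 := fun i => by exact_mod_cast i.2.le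
  have hjkl : ∀ p q : Fin D × Fin K, (p.2 : ℕ) * (e q).1 + (p.2 : ℕ) * (e q).2 ≤ D :=
    fun p q => (Nat.add_le_add (Nat.mul_le_mul p.2.2.le (e q).1.2.le)
      (Nat.mul_le_mul p.2.2.le (e q).2.2.le)).trans hKSD
  have ht3 : ∀ q, |t q| ≤ (m : ℝ) ^ 3 := by
    intro q
    have h := norm_natCast_add_mul_le
      ((hσC (Complex.ofRealHom.comp φ)).2.1.trans hCm) (hfin (e q).1) (hfin (e q).2)
    rw [← Real.norm_eq_abs, ← Complex.norm_real]
    simpa [ht] using h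
  have hm1 : (1 : ℝ) ≤ m := hC1.trans hCm
  have harith := NumberField.one_le_abs_det_mul_pow φ A (fun h => hdet0 (by rw [h, map_zero])) hy0
    (2 * D) (H := (m : ℝ) ^ (4 * D)) (fun p q => by
      refine isIntegral_interpolation_entry ?_ hy.1 hy.2.1 hy.2.2 _ _ _ _ _ ?_
      · exact isIntegral_algebraMap (R := ℤ) (A := F) (x := y)
      · have h1 := hjkl p q
        have h2 := p.1.2
        omega) (fun σ p q => by
      simp only [hA, Matrix.of_apply, map_mul, map_pow, map_add, map_natCast]
      exact norm_interpolation_entry_le hC1 hCm (hσC σ).1 (hσC σ).2.1 (hσC σ).2.2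
        (S := m ^ 2) (by push_cast; rfl) p.1.2.le (e q).1.2.le (e q).2.2.le (hjkl p q))
  have hanal := abs_det_pow_mul_exp_le lam t ((m : ℝ) ^ 3) m (one_le_pow₀ hm1) hm1 ht3
  rw [← hdet] at hanal
  simp only [Fintype.card_prod, Fintype.card_fin] at harith
  exact interpolation_bounds_absurd hd0 hK rfl (by rw [hcard]; push_cast; rfl) hDpos
    (by exact_mod_cast hn2.trans hnm) hlamC (hne.trans hnm') (abs_nonneg _) (hyC.trans hCm)
    (abs_nonneg _) hanal harith

open IntermediateField in
/-- The **Gelfond–Schneider theorem** for real powers. -/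
theorem transcendental_rpow {α β : ℝ} (hα0 : 0 < α) (hα1 : α ≠ 1) (hα : IsAlgebraic ℚ α)
    (hβ : IsAlgebraic ℚ β) (hβi : Irrational β) : Transcendental ℚ (α ^ β) := by
  intro hτ
  let F := IntermediateField.adjoin ℚ ({α, β, α ^ β} : Set ℝ)
  have : FiniteDimensional ℚ F := finiteDimensional_adjoin (by
    rintro x (rfl | rfl | rfl)
    exacts [hα.isIntegral, hβ.isIntegral, hτ.isIntegral])
  have : NumberField F := ⟨⟩
  have hmem : ∀ x ∈ ({α, β, α ^ β} : Set ℝ), x ∈ F := fun x hx => subset_adjoin ℚ _ hx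
  exact NumberField.ne_rpow_of_irrational (algebraMap F ℝ) ⟨α, hmem _ (by simp)⟩
    ⟨β, hmem _ (by simp)⟩ ⟨α ^ β, hmem _ (by simp)⟩ hα0 hα1 hβi rfl

/-! ### The conjugate system of equations. -/

theorem eq_one_of_isAlgebraic_rpow_sqrt_two {g : ℚ} (hg : 0 < g)
    (h : IsAlgebraic ℚ ((g : ℝ) ^ Real.sqrt 2)) : g = 1 := by
  by_contra h1
  refine transcendental_rpow (α := (g : ℝ)) (by exact_mod_cast hg) (by exact_mod_cast h1)
    (isAlgebraic_algebraMap g) ?_ irrational_sqrt_two h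
  refine IsAlgebraic.of_pow (n := 2) two_pos ?_
  rw [Real.sq_sqrt zero_le_two]
  exact_mod_cast isAlgebraic_algebraMap (A := ℝ) (2 : ℚ)

open Polynomial in
theorem isAlgebraic_of_sub_inv_eq {T : ℝ} {ρ : ℚ} (hT : T ≠ 0) (h : T - T⁻¹ = ρ) :
    IsAlgebraic ℚ T := by
  refine ⟨X ^ 2 - C ρ * X - 1, fun h0 => ?_, ?_⟩
  · simpa [coeff_X, coeff_one] using congrArg (fun f => coeff f 2) h0
  · simp only [map_sub, map_mul, map_pow, aeval_X, aeval_C, map_one, eq_ratCast, ← h]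
    field_simp
    ring

/-- No conjugate pair of equations `A g^√2 - B h^√2 = C j^√2`, `A g^(-√2) + B h^(-√2) = C j^(-√2)`
holds in positive rationals. -/
theorem conjugate_rpow_sqrt_two_absurd {A B C g h j : ℚ} (hA : 0 < A) (hB : 0 < B) (hC : 0 < C)
    (hg : 0 < g) (hh : 0 < h) (hj : 0 < j)
    (h1 : (A : ℝ) * (g : ℝ) ^ Real.sqrt 2 - B * (h : ℝ) ^ Real.sqrt 2 = C * (j : ℝ) ^ Real.sqrt 2)
    (h2 : (A : ℝ) * ((g : ℝ) ^ Real.sqrt 2)⁻¹ + B * ((h : ℝ) ^ Real.sqrt 2)⁻¹ =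
      C * ((j : ℝ) ^ Real.sqrt 2)⁻¹) : False := by
  have hg' : (0 : ℝ) < g := by exact_mod_cast hg
  have hh' : (0 : ℝ) < h := by exact_mod_cast hh
  have hj' : (0 : ℝ) < j := by exact_mod_cast hj
  have hA' : (0 : ℝ) < A := by exact_mod_cast hA
  have hB' : (0 : ℝ) < B := by exact_mod_cast hB
  have hC' : (0 : ℝ) < C := by exact_mod_cast hC
  have hgh : ((g / h : ℚ) : ℝ) ^ Real.sqrt 2 = (g : ℝ) ^ Real.sqrt 2 / (h : ℝ) ^ Real.sqrt 2 := by
    push_cast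
    exact Real.div_rpow hg'.le hh'.le _
  have hgj : ((g / j : ℚ) : ℝ) ^ Real.sqrt 2 = (g : ℝ) ^ Real.sqrt 2 / (j : ℝ) ^ Real.sqrt 2 := by
    push_cast
    exact Real.div_rpow hg'.le hj'.le _
  have hX : (0 : ℝ) < (g : ℝ) ^ Real.sqrt 2 := Real.rpow_pos_of_pos hg' _
  have hY : (0 : ℝ) < (h : ℝ) ^ Real.sqrt 2 := Real.rpow_pos_of_pos hh' _
  have hZ : (0 : ℝ) < (j : ℝ) ^ Real.sqrt 2 := Real.rpow_pos_of_pos hj' _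
  -- The product of the two equations is A² - B² + AB(T - T⁻¹) = C² with T = (g/h)^√2.
  have hT : g / h = 1 := by
    refine eq_one_of_isAlgebraic_rpow_sqrt_two (by positivity) (isAlgebraic_of_sub_inv_eq
      (ρ := (C ^ 2 - A ^ 2 + B ^ 2) / (A * B)) ?_ ?_)
    · rw [hgh]; positivity
    · rw [hgh]
      generalize (g : ℝ) ^ Real.sqrt 2 = X at *
      generalize (h : ℝ) ^ Real.sqrt 2 = Y at *
      generalize (j : ℝ) ^ Real.sqrt 2 = Z at *
      have h3 : (A * X - B * Y) * (A * X⁻¹ + B * Y⁻¹) = (C : ℝ) ^ 2 := by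
        rw [h1, h2]
        field_simp
      push_cast
      rw [← h3]
      field_simp
      ring
  obtain rfl : g = h := by rwa [div_eq_one_iff_eq hh.ne'] at hT
  have h3 : (A - B : ℝ) * (g : ℝ) ^ Real.sqrt 2 = C * (j : ℝ) ^ Real.sqrt 2 := by linarith
  have hAB : (A - B : ℝ) ≠ 0 := by
    intro h0
    rw [h0, zero_mul] at h3
    exact absurd h3.symm (by positivity)
  have hS : g / j = 1 := by
    refine eq_one_of_isAlgebraic_rpow_sqrt_two (by positivity) ?_
    have h4 : (g : ℝ) ^ Real.sqrt 2 / (j : ℝ) ^ Real.sqrt 2 = ((C / (A - B) : ℚ) : ℝ) := by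
      push_cast
      rw [div_eq_div_iff hZ.ne' hAB]
      linarith
    rw [hgj, h4]
    exact isAlgebraic_algebraMap (A := ℝ) (C / (A - B))
  obtain rfl : g = j := by rwa [div_eq_one_iff_eq hj.ne'] at hS
  have h5 : (A - B : ℝ) = C := mul_right_cancel₀ hX.ne' h3
  -- Once g = h = j the powers cancel from both equations, and A - B = A + B is absurd.
  have h6 : (A + B : ℝ) = C := mul_right_cancel₀ (inv_ne_zero hX.ne') (by rw [← h2]; ring)
  linarith

theorem natCast_rpow_realSqrtTwo {x : ℕ} (hx : 0 < x) (u : ℤ√2) :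
    (x : ℝ) ^ realSqrtTwo u =
      (((x : ℚ) ^ u.re : ℚ) : ℝ) * (((x : ℚ) ^ u.im : ℚ) : ℝ) ^ Real.sqrt 2 := by
  have hx' : (0 : ℝ) < x := by exact_mod_cast hx
  obtain ⟨m, n⟩ := u
  rw [realSqrtTwo_mk, Real.rpow_add hx', Real.rpow_mul hx'.le, Real.rpow_intCast,
    Real.rpow_intCast]
  push_cast
  rfl

theorem natCast_rpow_realSqrtTwo_conj {x : ℕ} (hx : 0 < x) (u : ℤ√2) :
    (x : ℝ) ^ realSqrtTwo (conjSqrtTwo u) =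
      (((x : ℚ) ^ u.re : ℚ) : ℝ) * ((((x : ℚ) ^ u.im : ℚ) : ℝ) ^ Real.sqrt 2)⁻¹ := by
  have hx' : (0 : ℝ) < x := by exact_mod_cast hx
  obtain ⟨m, n⟩ := u
  rw [natCast_rpow_realSqrtTwo hx, conjSqrtTwo_mk, ← Real.inv_rpow (by positivity)]
  push_cast
  rw [zpow_neg]

theorem proposition3p7
    (a b c : ℕ) (ha : 0 < a) (hb : 0 < b) (hc : 0 < c)
    (hab : Nat.Coprime a b) (hac : Nat.Coprime a c) (hbc : Nat.Coprime b c)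
    (u v w : ℤ√2)
    (hu : ∃ k : ℕ, 0 < k ∧ u + conjSqrtTwo u = (k : ℤ√2))
    (hv : ∃ k : ℕ, 0 < k ∧ v + conjSqrtTwo v = (k : ℤ√2))
    (hw : ∃ k : ℕ, 0 < k ∧ w + conjSqrtTwo w = (k : ℤ√2))
    (huv : (u - conjSqrtTwo u) * (v - conjSqrtTwo v) ≠ 0) :
    ¬ ∃ x y z : ℕ, 0 < x ∧ 0 < y ∧ 0 < z ∧ x * y * z ≠ 1 ∧
      Nat.gcd (Nat.gcd x y) z = 1 ∧
      (a : ℝ) * (x : ℝ) ^ realSqrtTwo u - (b : ℝ) * (y : ℝ) ^ realSqrtTwo v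
        = (c : ℝ) * (z : ℝ) ^ realSqrtTwo w ∧
      (a : ℝ) * (x : ℝ) ^ realSqrtTwo (conjSqrtTwo u)
          + (b : ℝ) * (y : ℝ) ^ realSqrtTwo (conjSqrtTwo v)
        = (c : ℝ) * (z : ℝ) ^ realSqrtTwo (conjSqrtTwo w) := by
  rintro ⟨x, y, z, hx, hy, hz, -, -, h1, h2⟩
  rw [natCast_rpow_realSqrtTwo hx, natCast_rpow_realSqrtTwo hy, natCast_rpow_realSqrtTwo hz] at h1
  rw [natCast_rpow_realSqrtTwo_conj hx, natCast_rpow_realSqrtTwo_conj hy,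
    natCast_rpow_realSqrtTwo_conj hz] at h2
  refine conjugate_rpow_sqrt_two_absurd (A := a * (x : ℚ) ^ u.re) (B := b * (y : ℚ) ^ v.re)
    (C := c * (z : ℚ) ^ w.re) (g := (x : ℚ) ^ u.im) (h := (y : ℚ) ^ v.im) (j := (z : ℚ) ^ w.im)
    (by positivity) (by positivity) (by positivity) (by positivity) (by positivity)
    (by positivity) ?_ ?_
  · rw [Rat.cast_mul, Rat.cast_mul, Rat.cast_mul, Rat.cast_natCast, Rat.cast_natCast,
      Rat.cast_natCast, mul_assoc, mul_assoc, mul_assoc]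
    exact h1
  · rw [Rat.cast_mul, Rat.cast_mul, Rat.cast_mul, Rat.cast_natCast, Rat.cast_natCast,
      Rat.cast_natCast, mul_assoc, mul_assoc, mul_assoc]
    exact h2
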